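/- Throughout, $n\ge 0$ is an integer, $I_n=\{1,\dots,n\}$, and $\mathcal H,\widetilde{\mathcal H}$ are complex Hilbert spaces. A bounded operator $T$ on $\mathcal H$ is a near-isometry if there is $\delta>0$ with $\delta\|x\|\le\|Tx\|\le\|x\|$ for all $x\in\mathcal H$, and $T^{*m}T^{m+1}\mathcal H\subseteq T\mathcal H$ for every integer $m\ge 0$. Let $\{U_{ij}\}_{1\le i<j\le n}$ be commuting unitaries on $\mathcal H$ and put $U_{ji}:=U_{ij}^*$ for $i<j$. An $n$-tuple $T=(T_1,\dots,T_n)$ of near-isometries on $\mathcal H$ is a doubly twisted near-isometry with respect to $\{U_{ij}\}$ if, for all $i<j$ and all $k$, $$T_i^*T_j=U_{ij}^*T_jT_i^*,\qquad T_kU_{ij}=U_{ij}T_k,\qquad T_iT_j=U_{ij}T_jT_i .$$ An $n$-tuple of isometries is a doubly twisted isometry with respect to $\{U_{ij}\}$ if the first two of these relations hold. Tuples $T$ on $\mathcal H$ and $\widetilde T$ on $\widetilde{\mathcal H}$ are unitarily equivalent, $T\cong\widetilde T$, if there is a unitary $V:\mathcal H\to\widetilde{\mathcal H}$ with $VT_iV^*=\widetilde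 T_i$ for all $i$. For $A=\{a_1<\dots<a_m\}\subseteq I_n$ and $\boldsymbol k\in\mathbb N_0^{A}$ put $T_A^{\boldsymbol k}=T_{a_1}^{k_{a_1}}\cdots T_{a_m}^{k_{a_m}}$ (with $T_\emptyset^{\boldsymbol k}=I$), and let $$\mathcal D_A(T)=\bigcap_{\boldsymbol\ell\in\mathbb N_0^{I_n\setminus A}}T_{I_n\setminus A}^{\boldsymbol\ell}\Bigl(\bigcap_{i\in A}\ker T_i^*\Bigr)$$ be the $A$-wandering subspace of $T$, where the inner intersection is $\mathcal H$ if $A=\emptyset$. **Theorem.** Let $T$ on $\mathcal H$ and $\widetilde T$ on $\widetilde{\mathcal H}$ be doubly twisted near-isometries with respect to $\{U_{ij}\}$ and $\{\widetilde U_{ij}\}$, respectively. For every $A\subseteq I_n$, the operators $(T_A^{\boldsymbol k})^*T_A^{\boldsymbol k}$ ($\boldsymbol k\in\mathbb N_0^{A}$), $T_j$ ($j\in I_n\setminus A$) and $U_{ij}$ ($i\ne j$) map $\mathcal D_A(T)$ into itself. Moreover, $T\cong\widetilde T$ if and only if for each $A\subseteq I_n$ there exists a unitary $V_A:\mathcal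 D_A(T)\to\mathcal D_A(\widetilde T)$ such that on $\mathcal D_A(T)$ 1. $V_A(T_A^{\boldsymbol k})^*T_A^{\boldsymbol k}=(\widetilde T_A^{\boldsymbol k})^*\widetilde T_A^{\boldsymbol k}V_A$ for all $\boldsymbol k\in\mathbb N_0^{A}$; 2. $V_AT_j=\widetilde T_jV_A$ for all $j\in I_n\setminus A$; 3. $V_AU_{ij}=\widetilde U_{ij}V_A$ for all $1\le i\ne j\le n$. Finally, every doubly twisted isometry is a doubly twisted near-isometry with respect to the same unitaries, and two doubly twisted isometries $T$ and $\widetilde T$ satisfy $T\cong\widetilde T$ if and only if for each $A\subseteq I_n$ there is a unitary $V_A:\mathcal D_A(T)\to\mathcal D_A(\widetilde T)$ satisfying 2 and 3 (that is, their $A$-wandering data are equivalent for all $A$). -/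

import Mathlib

open ContinuousLinearMap (adjoint)

/-- A near-isometry: a contraction that is bounded below and satisfies
`T*ⁿ Tⁿ⁺¹ H ⊆ T H` for every `n ≥ 0`. -/
structure IsNearIsometry {H : Type*} [NormedAddCommGroup H] [InnerProductSpace ℂ H]
    [CompleteSpace H] (T : H →L[ℂ] H) : Prop where
  bounded_below : ∃ δ : ℝ, 0 < δ ∧ ∀ x, δ * ‖x‖ ≤ ‖T x‖
  contraction : ∀ x, ‖T x‖ ≤ ‖x‖
  range_condition : ∀ (n : ℕ) (x : H), ∃ y : H, (adjoint T ^ n) ((T ^ (n + 1)) x) = T y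

/-- `U` restricted to the indices `i < j` is a commuting family of unitaries, extended to the
indices `i > j` by `U j i = (U i j)*`. The diagonal entries `U i i` are irrelevant (they occur in
no hypothesis and in no conclusion). -/
structure IsTwistingFamily {H : Type*} [NormedAddCommGroup H] [InnerProductSpace ℂ H]
    [CompleteSpace H] {n : ℕ} (U : Fin n → Fin n → H →L[ℂ] H) : Prop where
  mem_unitary : ∀ i j, i < j → U i j ∈ unitary (H →L[ℂ] H)
  commute : ∀ i j p q, i < j → p < q → U i j * U p q = U p q * U i j
  swap : ∀ i j, i < j → U j i = adjoint (U i j)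

/-- `T = (T₁, …, Tₙ)` is a doubly twisted near-isometry with respect to `U`. -/
structure IsDoublyTwistedNearIsometry {H : Type*} [NormedAddCommGroup H] [InnerProductSpace ℂ H]
    [CompleteSpace H] {n : ℕ} (T : Fin n → H →L[ℂ] H) (U : Fin n → Fin n → H →L[ℂ] H) :
    Prop where
  twisting : IsTwistingFamily U
  nearIsometry : ∀ i, IsNearIsometry (T i)
  adjoint_mul : ∀ i j, i < j → adjoint (T i) * T j = adjoint (U i j) * T j * adjoint (T i)
  commute : ∀ i j k, i < j → T k * U i j = U i j * T k
  mul_comm_twist : ∀ i j, i < j → T i * T j = U i j * T j * T i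

/-- `T = (T₁, …, Tₙ)` is a doubly twisted isometry with respect to `U`. -/
structure IsDoublyTwistedIsometry {H : Type*} [NormedAddCommGroup H] [InnerProductSpace ℂ H]
    [CompleteSpace H] {n : ℕ} (T : Fin n → H →L[ℂ] H) (U : Fin n → Fin n → H →L[ℂ] H) :
    Prop where
  twisting : IsTwistingFamily U
  isometry : ∀ i, Isometry (T i)
  adjoint_mul : ∀ i j, i < j → adjoint (T i) * T j = adjoint (U i j) * T j * adjoint (T i)
  commute : ∀ i j k, i < j → T k * U i j = U i j * T k

/-- Unitary equivalence of tuples: a single unitary `V` with `V Tᵢ V* = Sᵢ` for all `i`. -/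
def TupleUnitarilyEquivalent {H K : Type*} [NormedAddCommGroup H] [InnerProductSpace ℂ H]
    [NormedAddCommGroup K] [InnerProductSpace ℂ K] {n : ℕ}
    (T : Fin n → H →L[ℂ] H) (S : Fin n → K →L[ℂ] K) : Prop :=
  ∃ V : H ≃ₗᵢ[ℂ] K, ∀ (i : Fin n) (y : K), V (T i (V.symm y)) = S i y

/-- `T_A^k = T_{a₁}^{k_{a₁}} ⋯ T_{aₘ}^{k_{aₘ}}` for `A = {a₁ < ⋯ < aₘ}`. The exponents are indexed
by all of `Fin n`; only those with index in `A` matter. -/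
def tuplePow {H : Type*} [NormedAddCommGroup H] [InnerProductSpace ℂ H] {n : ℕ}
    (T : Fin n → H →L[ℂ] H) (A : Finset (Fin n)) (k : Fin n → ℕ) : H →L[ℂ] H :=
  (((List.finRange n).filter (fun a => a ∈ A)).map (fun a => T a ^ k a)).prod

/-- `W_A = ⋂_{i ∈ A} ker Tᵢ*`; in particular `W_∅` is the whole space. -/
noncomputable def kerSubspace {H : Type*} [NormedAddCommGroup H] [InnerProductSpace ℂ H] [CompleteSpace H]
    {n : ℕ} (T : Fin n → H →L[ℂ] H) (A : Finset (Fin n)) : Submodule ℂ H :=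
  ⨅ i ∈ A, LinearMap.ker (adjoint (T i) : H →ₗ[ℂ] H)

/-- The `A`-wandering subspace `D_A(T) = ⋂_ℓ T_{Aᶜ}^ℓ W_A`. -/
noncomputable def wanderingSubspace {H : Type*} [NormedAddCommGroup H] [InnerProductSpace ℂ H]
    [CompleteSpace H] {n : ℕ} (T : Fin n → H →L[ℂ] H) (A : Finset (Fin n)) : Submodule ℂ H :=
  ⨅ l : Fin n → ℕ, (kerSubspace T A).map (tuplePow T Aᶜ l : H →ₗ[ℂ] H)

/-- `V X = Y V` on `D`, where `V` is defined only on `D`: for `x ∈ D` the vector `X x` lies in `D`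
(so that `V` can be applied to it) and `V (X x) = Y (V x)`. -/
def IntertwinesOn {H K : Type*} [NormedAddCommGroup H] [InnerProductSpace ℂ H]
    [NormedAddCommGroup K] [InnerProductSpace ℂ K] {D : Submodule ℂ H} {E : Submodule ℂ K}
    (V : D ≃ₗᵢ[ℂ] E) (X : H →L[ℂ] H) (Y : K →L[ℂ] K) : Prop :=
  ∀ x : D, ∃ hx : X x ∈ D, (V ⟨X x, hx⟩ : K) = Y (V x)

/-- Equivalence of the `A`-wandering data of `(T, U)` and `(T', U')`. -/
def WanderingDataEquivalent {H K : Type*} [NormedAddCommGroup H] [InnerProductSpace ℂ H]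
    [CompleteSpace H] [NormedAddCommGroup K] [InnerProductSpace ℂ K] [CompleteSpace K] {n : ℕ}
    (T : Fin n → H →L[ℂ] H) (U : Fin n → Fin n → H →L[ℂ] H)
    (T' : Fin n → K →L[ℂ] K) (U' : Fin n → Fin n → K →L[ℂ] K) (A : Finset (Fin n)) : Prop :=
  ∃ V : wanderingSubspace T A ≃ₗᵢ[ℂ] wanderingSubspace T' A,
    (∀ j, j ∉ A → IntertwinesOn V (T j) (T' j)) ∧
    (∀ i j, i ≠ j → IntertwinesOn V (U i j) (U' i j))

/-
A near-isometry `S` has a Wold decomposition: the space is the Hilbert sum of the subspaces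
`S ^ k (ker S*)`, `k ≥ 0`, and `⋂ m, S ^ m H`. In a doubly twisted tuple, `T i` leaves every Wold
summand of `T j` invariant for `j ≠ i`, so the projections onto the summands of the different `T i`
commute and the space is the Hilbert sum of the joint summands. Those are exactly the subspaces
`T_A^k D_A(T)`.

Hence the vectors `T_A^k x` with `x ∈ D_A(T)` have dense span, and vectors with different `(A, k)`
are orthogonal. Within one summand, inner products are given by `(T_A^k)* T_A^k`. Wandering data
intertwined by unitaries `V_A` therefore yield a unitary sending `T_A^k x` to `T'_A^k (V_A x)`.
It intertwines `T i` with `T' i`, because moving `T i` past `T_A^k` either raises an exponent or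
lets `T i` act on `x`, up to a product of twists acting on `x`. Conversely, the twists are
determined by the tuple, so a unitary equivalence also intertwines them. For isometries
`(T_A^k)* T_A^k = 1`, and `T i T j = U i j T j T i` follows from the relation for `(T i)* T j`
because `a* a`, `b* b` and `a* b` are all `1` only when `a = b`.
-/

section HilbertSum

variable {𝕜 E ι : Type*} [RCLike 𝕜] [NormedAddCommGroup E] [InnerProductSpace 𝕜 E]

theorem starProjection_apply_mem_of_commute {M N : Submodule 𝕜 E} [M.HasOrthogonalProjection]
    [N.HasOrthogonalProjection] (h : Commute M.starProjection N.starProjection) {x : E}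
    (hx : x ∈ N) : M.starProjection x ∈ N := by
  rw [← Submodule.starProjection_eq_self_iff] at hx ⊢
  rw [← mul_apply_eq_comp, ← h.eq, mul_apply_eq_comp, hx]

theorem orthogonal_iSup_iInf_mem_eq_bot {κ : ι → Type*} {M : ∀ i, κ i → Submodule 𝕜 E}
    [∀ i, Nonempty (κ i)] [∀ i a, (M i a).HasOrthogonalProjection] (hM : ∀ i, (⨆ a, M i a)ᗮ = ⊥)
    (hcomm : ∀ i j, i ≠ j → ∀ a b, Commute (M i a).starProjection (M j b).starProjection)
    (s : Finset ι) : (⨆ φ : ∀ i, κ i, ⨅ i ∈ s, M i (φ i))ᗮ = ⊥ := by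
  classical
  simp only [← Submodule.iInf_orthogonal] at hM ⊢
  induction s using Finset.induction_on with
  | empty => simp
  | insert i s hi ih =>
    rw [Submodule.eq_bot_iff]
    intro x hx
    suffices hproj : ∀ a, (M i a).starProjection x = 0 by
      rw [← Submodule.mem_bot 𝕜, ← hM i, Submodule.mem_iInf]
      exact fun a => (Submodule.starProjection_apply_eq_zero_iff _).1 (hproj a)
    intro a
    -- `⨅ j ∈ s, M j (φ j)` is invariant under the projection onto `M i a`, so this projection
    -- maps `x` into the orthogonal complement of every such infimum.
    rw [← Submodule.mem_bot 𝕜, ← ih, Submodule.mem_iInf]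
    intro φ y hy
    simp only [Submodule.mem_iInf] at hx hy
    rw [← Submodule.inner_starProjection_left_eq_right]
    refine hx (Function.update φ i a) _ ?_
    simp only [Submodule.mem_iInf, Finset.forall_mem_insert]
    refine ⟨by simp, fun j hj => ?_⟩
    have hji : j ≠ i := ne_of_mem_of_not_mem hj hi
    rw [Function.update_of_ne hji]
    exact starProjection_apply_mem_of_commute (hcomm i j hji.symm a (φ j)) (hy j hj)

variable [CompleteSpace E]

/-- The ambient space is the Hilbert sum of the family of subspaces `M`, that is, `IsHilbertSum`
holds for the inclusion maps of the `M i`. -/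
abbrev IsInternalHilbertSum (M : ι → Submodule 𝕜 E) : Prop :=
  IsHilbertSum 𝕜 (fun i => M i) fun i => (M i).subtypeₗᵢ

namespace IsInternalHilbertSum

variable {M : ι → Submodule 𝕜 E}

theorem of_pairwise_isOrtho (hclosed : ∀ i, IsClosed (M i : Set E))
    (hortho : Pairwise fun i j => M i ⟂ M j) (htotal : (⨆ i, M i)ᗮ = ⊥) :
    IsInternalHilbertSum M := by
  have := fun i => (hclosed i).completeSpace_coe
  exact .mkInternal M (.of_pairwise hortho) (Submodule.topologicalClosure_eq_top_iff.2 htotal).ge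

theorem isOrtho (hM : IsInternalHilbertSum M) {i j : ι} (hij : i ≠ j) : M i ⟂ M j :=
  hM.OrthogonalFamily.isOrtho hij

theorem linearIsometryEquiv_apply_eq_zero (hM : IsInternalHilbertSum M) {i : ι} {x : E}
    (hx : x ∈ (M i)ᗮ) : hM.linearIsometryEquiv x i = 0 := by
  classical
  set f := hM.linearIsometryEquiv x with hf
  have hinner : inner 𝕜 (lp.single 2 i (f i)) f = inner 𝕜 (f i : E) x := by
    rw [← hM.linearIsometryEquiv.symm.inner_map_map, hM.linearIsometryEquiv_symm_apply_single, hf,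
      LinearIsometryEquiv.symm_apply_apply]
    rfl
  exact inner_self_eq_zero.1 <|
    (lp.inner_single_left i (f i) f).symm.trans (hinner.trans (hx _ (f i).2))

theorem orthogonal_iSup_eq_bot (hM : IsInternalHilbertSum M) : (⨆ i, M i)ᗮ = ⊥ := by
  rw [← Submodule.iInf_orthogonal, Submodule.eq_bot_iff]
  intro x hx
  rw [← hM.linearIsometryEquiv.map_eq_zero_iff]
  ext1
  funext i
  exact hM.linearIsometryEquiv_apply_eq_zero ((Submodule.mem_iInf _).1 hx i)

theorem mem_iff_forall_mem_orthogonal (hM : IsInternalHilbertSum M) {i : ι} {x : E} :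
    x ∈ M i ↔ ∀ j ≠ i, x ∈ (M j)ᗮ := by
  refine ⟨fun hx j hj => hM.isOrtho hj.symm hx, fun hx => ?_⟩
  have hsum := hM.hasSum_linearIsometryEquiv_symm (hM.linearIsometryEquiv x)
  rw [LinearIsometryEquiv.symm_apply_apply] at hsum
  rw [hsum.unique (hasSum_single i fun j hj => ?_)]
  · exact (hM.linearIsometryEquiv x i).2
  · rw [hM.linearIsometryEquiv_apply_eq_zero (hx j hj), map_zero]

theorem isClosed (hM : IsInternalHilbertSum M) (i : ι) : IsClosed (M i : Set E) := by
  have : M i = ⨅ (j) (_ : j ≠ i), (M j)ᗮ := by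
    ext x
    simp only [hM.mem_iff_forall_mem_orthogonal, Submodule.mem_iInf]
  rw [this]
  simp only [Submodule.coe_iInf]
  exact isClosed_iInter fun j => isClosed_iInter fun _ => (M j).isClosed_orthogonal

theorem hasOrthogonalProjection (hM : IsInternalHilbertSum M) (i : ι) :
    (M i).HasOrthogonalProjection :=
  have := (hM.isClosed i).completeSpace_coe
  inferInstance

theorem adjoint_apply_mem {F κ : Type*} [NormedAddCommGroup F] [InnerProductSpace 𝕜 F]
    [CompleteSpace F] {N : κ → Submodule 𝕜 F} {S : E →L[𝕜] F} {σ : ι → κ}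
    (hM : IsInternalHilbertSum M) (hN : Pairwise fun i j => N i ⟂ N j)
    (hσ : Function.Injective σ) (hS : ∀ i, ∀ x ∈ M i, S x ∈ N (σ i)) {i : ι} {y : F}
    (hy : y ∈ N (σ i)) : adjoint S y ∈ M i := by
  refine hM.mem_iff_forall_mem_orthogonal.2 fun j hj x hx => ?_
  rw [ContinuousLinearMap.adjoint_inner_right]
  exact (hN (hσ.ne hj)).inner_eq (hS j x hx) hy

theorem commute_starProjection {S : E →L[𝕜] E} (hM : IsInternalHilbertSum M)
    (hS : ∀ i, ∀ x ∈ M i, S x ∈ M i) (i : ι) [(M i).HasOrthogonalProjection] :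
    Commute (M i).starProjection S := by
  ext x
  refine Submodule.eq_starProjection_of_mem_orthogonal
    (hS i _ (Submodule.starProjection_apply_mem _ x)) fun y hy => ?_
  have hSy : adjoint S y ∈ M i :=
    hM.adjoint_apply_mem (fun _ _ => hM.isOrtho) Function.injective_id hS hy
  change inner 𝕜 y (S x - S _) = 0
  rw [← map_sub, ← ContinuousLinearMap.adjoint_inner_left]
  exact Submodule.sub_starProjection_mem_orthogonal x _ hSy

theorem mem_of_apply_mem {S : E →L[𝕜] E} (hM : IsInternalHilbertSum M)
    (hS : ∀ i, ∀ x ∈ M i, S x ∈ M i) (hinj : Function.Injective S) {i : ι} {x : E}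
    (hx : S x ∈ M i) : x ∈ M i := by
  have := hM.hasOrthogonalProjection i
  rw [← Submodule.starProjection_eq_self_iff] at hx ⊢
  refine hinj (Eq.trans ?_ hx)
  exact (DFunLike.congr_fun (hM.commute_starProjection hS i).eq x).symm

theorem iInf [Finite ι] {κ : ι → Type*} {M : ∀ i, κ i → Submodule 𝕜 E}
    [∀ i, Nonempty (κ i)] [∀ i a, (M i a).HasOrthogonalProjection]
    (hM : ∀ i, IsInternalHilbertSum (M i))
    (hcomm : ∀ i j, i ≠ j → ∀ a b, Commute (M i a).starProjection (M j b).starProjection) :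
    IsInternalHilbertSum fun φ : ∀ i, κ i => ⨅ i, M i (φ i) := by
  cases nonempty_fintype ι
  refine .of_pairwise_isOrtho (fun φ => ?_) (fun φ ψ hne => ?_) ?_
  · simp only [Submodule.coe_iInf]
    exact isClosed_iInter fun i => (hM i).isClosed (φ i)
  · obtain ⟨i, hi⟩ := Function.ne_iff.1 hne
    exact ((hM i).isOrtho hi).mono (iInf_le _ i) (iInf_le _ i)
  · simpa using orthogonal_iSup_iInf_mem_eq_bot (fun i => (hM i).orthogonal_iSup_eq_bot) hcomm
      Finset.univ

end IsInternalHilbertSum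

end HilbertSum

theorem exists_linearIsometryEquiv_of_inner_eq {𝕜 E F ι : Type*} [RCLike 𝕜]
    [NormedAddCommGroup E] [InnerProductSpace 𝕜 E] [CompleteSpace E]
    [NormedAddCommGroup F] [InnerProductSpace 𝕜 F] [CompleteSpace F] {p : ι → E} {q : ι → F}
    (hinner : ∀ i j, inner 𝕜 (p i) (p j) = inner 𝕜 (q i) (q j))
    (hp : Dense (Submodule.span 𝕜 (Set.range p) : Set E))
    (hq : Dense (Submodule.span 𝕜 (Set.range q) : Set F)) :
    ∃ V : E ≃ₗᵢ[𝕜] F, ∀ i, V (p i) = q i := by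
  rw [← Finsupp.range_linearCombination, LinearMap.coe_range] at hp hq
  have hnorm : ∀ f : ι →₀ 𝕜, ‖Finsupp.linearCombination 𝕜 q (LinearEquiv.refl 𝕜 _ f)‖ =
      ‖Finsupp.linearCombination 𝕜 p f‖ := by
    intro f
    simp only [LinearEquiv.refl_apply, @norm_eq_sqrt_re_inner 𝕜, Finsupp.linearCombination_apply,
      Finsupp.sum_inner, Finsupp.inner_sum, inner_smul_left, inner_smul_right, hinner]
  refine ⟨(LinearEquiv.refl 𝕜 (ι →₀ 𝕜)).extendOfIsometry _ _ hp hq hnorm, fun i => ?_⟩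
  simpa using LinearEquiv.extendOfIsometry_eq _ _ _ hp hq hnorm (Finsupp.single i 1)

theorem star_mul_mul_self_eq_one {R : Type*} [Monoid R] [StarMul R] {a b : R}
    (ha : star a * a = 1) (hb : star b * b = 1) : star (a * b) * (a * b) = 1 := by
  rw [star_mul, mul_assoc, ← mul_assoc (star a), ha, one_mul, hb]

section ListPow

variable {ι M : Type*} [Monoid M]

/-- The ordered monomial `t a₁ ^ k a₁ * ⋯ * t aₘ ^ k aₘ` for the list `L = [a₁, …, aₘ]`; `tuplePow`
is the case of the increasing list of the elements of a finite set. -/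
def listPow (t : ι → M) (L : List ι) (k : ι → ℕ) : M := (L.map fun a => t a ^ k a).prod

variable {t u : ι → M} {L : List ι} {k l : ι → ℕ}

@[simp] theorem listPow_nil : listPow t [] k = 1 := rfl

@[simp] theorem listPow_cons (a : ι) : listPow t (a :: L) k = t a ^ k a * listPow t L k := by
  simp only [listPow, List.map_cons, List.prod_cons]

theorem listPow_append (L₁ L₂ : List ι) :
    listPow t (L₁ ++ L₂) k = listPow t L₁ k * listPow t L₂ k := by
  simp only [listPow, List.map_append, List.prod_append]

theorem listPow_congr (h : ∀ a ∈ L, k a = l a) : listPow t L k = listPow t L l := by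
  rw [listPow, listPow, List.map_congr_left fun a ha => by rw [h a ha]]

theorem map_listPow {N F : Type*} [Monoid N] [FunLike F M N] [MonoidHomClass F M N] (f : F) :
    f (listPow t L k) = listPow (fun a => f (t a)) L k := by
  simp only [listPow, map_list_prod, List.map_map, Function.comp_def, map_pow]

theorem commute_listPow {s : M} (h : ∀ a ∈ L, Commute s (t a)) : Commute s (listPow t L k) := by
  refine Commute.list_prod_right _ _ fun b hb => ?_
  obtain ⟨a, ha, rfl⟩ := List.mem_map.1 hb
  exact (h a ha).pow_right _

theorem mul_listPow {s : M} (hs : ∀ a ∈ L, SemiconjBy s (t a) (u a * t a))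
    (hu : ∀ a ∈ L, ∀ b ∈ L, Commute (u a) (t b)) :
    s * listPow t L k = listPow t L k * (listPow u L k * s) := by
  induction L with
  | nil => simp
  | cons a L ih =>
    have hpow : s * t a ^ k a = u a ^ k a * t a ^ k a * s := by
      rw [← (hu a (by simp) a (by simp)).mul_pow]
      exact (hs a (by simp)).pow_right _
    have hcomm : Commute (u a ^ k a) (listPow t (a :: L) k) :=
      (commute_listPow fun b hb => hu a (by simp) b hb).pow_left _
    simp only [List.mem_cons] at hs hu
    have ih := ih (fun b hb => hs b (.inr hb)) fun b hb c hc => hu b (.inr hb) c (.inr hc)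
    calc s * listPow t (a :: L) k
        = u a ^ k a * t a ^ k a * (s * listPow t L k) := by
          rw [listPow_cons, ← mul_assoc, hpow, mul_assoc]
      _ = u a ^ k a * listPow t (a :: L) k * (listPow u L k * s) := by
          rw [ih, listPow_cons]; simp only [mul_assoc]
      _ = listPow t (a :: L) k * (listPow u (a :: L) k * s) := by
          rw [hcomm.eq, listPow_cons (t := u)]; simp only [mul_assoc]

theorem mul_listPow_append_cons [DecidableEq ι] {i : ι} {L₁ L₂ : List ι}
    (h₁ : i ∉ L₁) (h₂ : i ∉ L₂) (hs : ∀ a ∈ L₁, SemiconjBy (t i) (t a) (u a * t a))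
    (hu : ∀ a ∈ L₁, ∀ b ∈ L₁ ++ i :: L₂, Commute (u a) (t b)) :
    t i * listPow t (L₁ ++ i :: L₂) k =
      listPow t (L₁ ++ i :: L₂) (Function.update k i (k i + 1)) * listPow u L₁ k := by
  have hupdate : ∀ L : List ι, i ∉ L →
      listPow t L (Function.update k i (k i + 1)) = listPow t L k := fun L hL =>
    listPow_congr fun a ha => Function.update_of_ne (ne_of_mem_of_not_mem ha hL) _ _
  have hmul := mul_listPow (k := k) hs fun a ha b hb => hu a ha b (List.mem_append_left _ hb)
  have hcomm : Commute (listPow u L₁ k) (t i ^ (k i + 1) * listPow t L₂ k) := by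
    rw [← Function.update_self i (k i + 1) k, ← hupdate L₂ h₂, ← listPow_cons]
    refine commute_listPow fun b hb => (commute_listPow fun a ha => ?_).symm
    exact (hu a ha b (List.mem_append_right _ hb)).symm
  calc t i * listPow t (L₁ ++ i :: L₂) k
      = listPow t L₁ k * (listPow u L₁ k * (t i ^ (k i + 1) * listPow t L₂ k)) := by
        rw [listPow_append, ← mul_assoc, hmul, listPow_cons, pow_succ']
        simp only [mul_assoc]
    _ = listPow t (L₁ ++ i :: L₂) (Function.update k i (k i + 1)) * listPow u L₁ k := by
        rw [hcomm.eq, listPow_append, listPow_cons, hupdate L₁ h₁, hupdate L₂ h₂,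
          Function.update_self]
        simp only [mul_assoc]

theorem star_listPow_mul_self [StarMul M] (ht : ∀ a ∈ L, star (t a) * t a = 1) :
    star (listPow t L k) * listPow t L k = 1 := by
  induction L with
  | nil => simp
  | cons a L ih =>
    rw [List.forall_mem_cons] at ht
    have hpow : star (t a ^ k a) * t a ^ k a = 1 := by
      rw [star_pow, pow_mul_pow_eq_one _ ht.1]
    rw [listPow_cons]
    exact star_mul_mul_self_eq_one hpow (ih ht.2)

end ListPow

section Wold

variable {H : Type*} [NormedAddCommGroup H] [InnerProductSpace ℂ H] [CompleteSpace H]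
  {T : H →L[ℂ] H}

/-- The summands of the Wold decomposition of `T`: the summand with finite index `k` is
`T ^ k (ker T*)`, and the summand with index `⊤` is the part on which `T` is invertible, namely
`⋂ m, T ^ m H`. -/
noncomputable def woldSubspace (T : H →L[ℂ] H) (c : ℕ∞) : Submodule ℂ H :=
  ENat.recTopCoe (C := fun _ => Submodule ℂ H)
    (⨅ m : ℕ, LinearMap.range ((T ^ m : H →L[ℂ] H) : H →ₗ[ℂ] H))
    (fun k => (LinearMap.ker (adjoint T : H →ₗ[ℂ] H)).map ((T ^ k : H →L[ℂ] H) : H →ₗ[ℂ] H)) c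

theorem woldSubspace_top :
    woldSubspace T ⊤ = ⨅ m : ℕ, LinearMap.range ((T ^ m : H →L[ℂ] H) : H →ₗ[ℂ] H) := rfl

theorem woldSubspace_coe (k : ℕ) : woldSubspace T k =
    (LinearMap.ker (adjoint T : H →ₗ[ℂ] H)).map ((T ^ k : H →L[ℂ] H) : H →ₗ[ℂ] H) := rfl

theorem mem_woldSubspace_top {x : H} : x ∈ woldSubspace T ⊤ ↔ ∀ m : ℕ, ∃ y, (T ^ m) y = x :=
  Submodule.mem_iInf _

theorem mem_woldSubspace_coe {k : ℕ} {x : H} :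
    x ∈ woldSubspace T k ↔ ∃ w, adjoint T w = 0 ∧ (T ^ k) w = x := Iff.rfl

theorem woldSubspace_zero : woldSubspace T 0 = LinearMap.ker (adjoint T : H →ₗ[ℂ] H) := by
  ext x
  simpa using mem_woldSubspace_coe (T := T) (k := 0) (x := x)

theorem woldSubspace_le_range_pow {c : ℕ∞} {m : ℕ} (h : (m : ℕ∞) ≤ c) :
    woldSubspace T c ≤ LinearMap.range ((T ^ m : H →L[ℂ] H) : H →ₗ[ℂ] H) := by
  induction c with
  | top => exact iInf_le _ m
  | coe k =>
    obtain ⟨l, rfl⟩ := Nat.exists_eq_add_of_le (Nat.cast_le.1 h)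
    rintro _ ⟨w, -, rfl⟩
    exact ⟨(T ^ l) w, by rw [pow_add]; rfl⟩

theorem map_pow_woldSubspace (hT : Function.Injective T) (c : ℕ∞) (m : ℕ) :
    (woldSubspace T c).map ((T ^ m : H →L[ℂ] H) : H →ₗ[ℂ] H) = woldSubspace T (c + m) := by
  have hinj : Function.Injective (T ^ m : H →L[ℂ] H) := by
    rw [FunLike.coe_pow_eq_iterate]
    exact hT.iterate m
  induction c with
  | top =>
    rw [top_add]
    refine le_antisymm ?_ fun x hx => ?_
    · rintro _ ⟨x, hx, rfl⟩
      refine mem_woldSubspace_top.2 fun l => ?_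
      obtain ⟨y, rfl⟩ := mem_woldSubspace_top.1 hx l
      exact ⟨(T ^ m) y, DFunLike.congr_fun (Commute.pow_pow_self T l m) y⟩
    · obtain ⟨y, rfl⟩ := mem_woldSubspace_top.1 hx m
      refine ⟨y, mem_woldSubspace_top.2 fun l => ?_, rfl⟩
      obtain ⟨z, hz⟩ := mem_woldSubspace_top.1 hx (m + l)
      exact ⟨z, hinj (by rw [← hz, pow_add]; rfl)⟩
  | coe k =>
    rw [← Nat.cast_add, woldSubspace_coe, woldSubspace_coe, ← Submodule.map_comp, add_comm, pow_add]
    rfl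

theorem apply_mem_woldSubspace {S u v : H →L[ℂ] H} (h : SemiconjBy S T (u * T))
    (hu : Commute u T) (hu' : Commute u (adjoint T)) (h' : adjoint T * S = v * adjoint T)
    {c : ℕ∞} {x : H} (hx : x ∈ woldSubspace T c) : S x ∈ woldSubspace T c := by
  have hpow : ∀ k : ℕ, S * T ^ k = T ^ k * (u ^ k * S) := fun k => by
    rw [(h.pow_right k).eq, hu.mul_pow, (hu.pow_pow k k).eq, mul_assoc]
  induction c with
  | top =>
    rw [mem_woldSubspace_top] at hx ⊢
    intro m
    obtain ⟨y, rfl⟩ := hx m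
    exact ⟨_, (DFunLike.congr_fun (hpow m) y).symm⟩
  | coe k =>
    obtain ⟨w, hw, rfl⟩ := mem_woldSubspace_coe.1 hx
    refine mem_woldSubspace_coe.2 ⟨(u ^ k * S) w, ?_, (DFunLike.congr_fun (hpow k) w).symm⟩
    have hadj : adjoint T * (u ^ k * S) = u ^ k * v * adjoint T := by
      rw [← mul_assoc, ← (hu'.pow_left k).eq, mul_assoc, h', mul_assoc]
    calc adjoint T ((u ^ k * S) w) = (u ^ k * v) (adjoint T w) := DFunLike.congr_fun hadj w
      _ = 0 := by rw [hw, map_zero]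

theorem apply_mem_woldSubspace_of_commute {S : H →L[ℂ] H} (h : Commute S T)
    (h' : Commute S (adjoint T)) {c : ℕ∞} {x : H} (hx : x ∈ woldSubspace T c) :
    S x ∈ woldSubspace T c :=
  apply_mem_woldSubspace (u := 1) (by rwa [one_mul]) (.one_left T) (.one_left _) h'.eq.symm hx

namespace IsNearIsometry

theorem isClosedEmbedding (hT : IsNearIsometry T) : Topology.IsClosedEmbedding T := by
  obtain ⟨δ, hδ, hbound⟩ := hT.bounded_below
  refine (T.antilipschitz_of_bound (K := ⟨δ⁻¹, (inv_pos.2 hδ).le⟩) fun x => ?_).isClosedEmbedding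
    T.uniformContinuous
  exact (le_inv_mul_iff₀ hδ).2 (hbound x)

theorem injective (hT : IsNearIsometry T) : Function.Injective T :=
  hT.isClosedEmbedding.injective

theorem isClosedEmbedding_pow (hT : IsNearIsometry T) (k : ℕ) :
    Topology.IsClosedEmbedding (T ^ k : H →L[ℂ] H) := by
  induction k with
  | zero => exact .id
  | succ k ih => rw [pow_succ]; exact ih.comp hT.isClosedEmbedding

theorem isClosed_woldSubspace (hT : IsNearIsometry T) (c : ℕ∞) :
    IsClosed (woldSubspace T c : Set H) := by
  induction c with
  | top =>
    rw [woldSubspace_top, Submodule.coe_iInf]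
    exact isClosed_iInter fun m => (hT.isClosedEmbedding_pow m).isClosed_range
  | coe k => exact (hT.isClosedEmbedding_pow k).isClosedMap _ (adjoint T).isClosed_ker

theorem woldSubspace_isOrtho_range_pow_succ (hT : IsNearIsometry T) (k : ℕ) :
    woldSubspace T k ⟂ LinearMap.range ((T ^ (k + 1) : H →L[ℂ] H) : H →ₗ[ℂ] H) := by
  rw [Submodule.isOrtho_iff_inner_eq]
  rintro x hx _ ⟨y, rfl⟩
  obtain ⟨w, hw, rfl⟩ := mem_woldSubspace_coe.1 hx
  obtain ⟨z, hz⟩ := hT.range_condition k y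
  have hadj : adjoint (T ^ k) = adjoint T ^ k := star_pow T k
  rw [ContinuousLinearMap.coe_coe, ← ContinuousLinearMap.adjoint_inner_right, hadj, hz,
    ← ContinuousLinearMap.adjoint_inner_left, hw, inner_zero_left]

theorem pairwise_isOrtho_woldSubspace (hT : IsNearIsometry T) :
    Pairwise fun c d => woldSubspace T c ⟂ woldSubspace T d := by
  have hlt : ∀ {c d : ℕ∞}, c < d → woldSubspace T c ⟂ woldSubspace T d := by
    intro c d hcd
    lift c to ℕ using hcd.ne_top
    exact (hT.woldSubspace_isOrtho_range_pow_succ c).mono_right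
      (woldSubspace_le_range_pow (Order.add_one_le_of_lt hcd))
  exact fun c d hcd => hcd.lt_or_gt.elim hlt fun h => (hlt h).symm

theorem mem_woldSubspace_top_of_forall_mem_orthogonal (hT : IsNearIsometry T) {x : H}
    (hx : ∀ k : ℕ, x ∈ (woldSubspace T k)ᗮ) : x ∈ woldSubspace T ⊤ := by
  refine mem_woldSubspace_top.2 fun m => ?_
  induction m with
  | zero => exact ⟨x, rfl⟩
  | succ m ih =>
    obtain ⟨y, rfl⟩ := ih
    have hclosed : IsClosed (LinearMap.range (T : H →ₗ[ℂ] H) : Set H) :=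
      hT.isClosedEmbedding.isClosed_range
    have := hclosed.completeSpace_coe
    obtain ⟨_, ⟨z, rfl⟩, w, hw, rfl⟩ :=
      (LinearMap.range (T : H →ₗ[ℂ] H)).exists_add_mem_mem_orthogonal y
    rw [ContinuousLinearMap.orthogonal_range] at hw
    have hTz : (T ^ m) (T z) = (T ^ (m + 1)) z := by rw [pow_succ]; rfl
    rw [ContinuousLinearMap.coe_coe, map_add, hTz] at hx ⊢
    have hTw : (T ^ m) w ∈ woldSubspace T m := mem_woldSubspace_coe.2 ⟨w, hw, rfl⟩
    have hzero : inner ℂ ((T ^ m) w) ((T ^ m) w) = 0 := by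
      have hortho : inner ℂ ((T ^ m) w) ((T ^ (m + 1)) z) = 0 :=
        (hT.woldSubspace_isOrtho_range_pow_succ m).inner_eq hTw ⟨z, rfl⟩
      rw [← hx m _ hTw, inner_add_right, hortho, zero_add]
    exact ⟨z, by rw [inner_self_eq_zero.1 hzero, add_zero]⟩

theorem isInternalHilbertSum_woldSubspace (hT : IsNearIsometry T) :
    IsInternalHilbertSum (woldSubspace T) := by
  refine .of_pairwise_isOrtho hT.isClosed_woldSubspace hT.pairwise_isOrtho_woldSubspace ?_
  rw [← Submodule.iInf_orthogonal, Submodule.eq_bot_iff]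
  intro x hx
  rw [Submodule.mem_iInf] at hx
  have htop := hT.mem_woldSubspace_top_of_forall_mem_orthogonal fun k => hx k
  exact inner_self_eq_zero.1 (hx ⊤ x htop)

end IsNearIsometry

end Wold

section TwistRelations

variable {H : Type*} [NormedAddCommGroup H] [InnerProductSpace ℂ H] [CompleteSpace H] {n : ℕ}
  {T : Fin n → H →L[ℂ] H} {U : Fin n → Fin n → H →L[ℂ] H} {i j : Fin n}

theorem commute_star_of_mem_unitary {R : Type*} [Monoid R] [StarMul R] {u x : R}
    (hu : u ∈ unitary R) (h : Commute x u) : Commute x (star u) :=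
  Commute.units_inv_right (u := Unitary.toUnits ⟨u, hu⟩) h

theorem IsTwistingFamily.adjoint_eq (hU : IsTwistingFamily U) (hij : i ≠ j) :
    adjoint (U i j) = U j i := by
  rcases hij.lt_or_gt with hlt | hgt
  · exact (hU.swap i j hlt).symm
  · rw [hU.swap j i hgt, ContinuousLinearMap.adjoint_adjoint]

theorem IsTwistingFamily.mul_swap (hU : IsTwistingFamily U) (hij : i ≠ j) :
    U i j * U j i = 1 := by
  rcases hij.lt_or_gt with hlt | hgt
  · rw [hU.swap i j hlt]
    exact Unitary.mul_star_self_of_mem (hU.mem_unitary i j hlt)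
  · rw [hU.swap j i hgt]
    exact Unitary.star_mul_self_of_mem (hU.mem_unitary j i hgt)

namespace IsDoublyTwistedNearIsometry

theorem commute_twist (h : IsDoublyTwistedNearIsometry T U) (hij : i ≠ j) (k : Fin n) :
    Commute (T k) (U i j) := by
  rcases hij.lt_or_gt with hlt | hgt
  · exact h.commute i j k hlt
  · rw [h.twisting.swap j i hgt]
    exact commute_star_of_mem_unitary (h.twisting.mem_unitary j i hgt) (h.commute j i k hgt)

theorem commute_adjoint_twist (h : IsDoublyTwistedNearIsometry T U) (hij : i ≠ j) (k : Fin n) :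
    Commute (adjoint (T k)) (U i j) := by
  rw [← h.twisting.adjoint_eq hij.symm]
  exact (h.commute_twist hij.symm k).star_star

theorem mul_eq_twist_mul (h : IsDoublyTwistedNearIsometry T U) (hij : i ≠ j) :
    T i * T j = U i j * (T j * T i) := by
  rcases hij.lt_or_gt with hlt | hgt
  · rw [h.mul_comm_twist i j hlt, mul_assoc]
  · rw [h.mul_comm_twist j i hgt, mul_assoc, ← mul_assoc, h.twisting.mul_swap hij, one_mul]

theorem adjoint_mul_eq_twist_mul (h : IsDoublyTwistedNearIsometry T U) (hij : i ≠ j) :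
    adjoint (T i) * T j = U j i * T j * adjoint (T i) := by
  rcases hij.lt_or_gt with hlt | hgt
  · rw [h.adjoint_mul i j hlt, h.twisting.adjoint_eq hij]
  · have hadj := congrArg star (h.adjoint_mul j i hgt)
    simp only [star_mul, ContinuousLinearMap.star_eq_adjoint,
      ContinuousLinearMap.adjoint_adjoint] at hadj
    rw [hadj, ← mul_assoc, ((h.commute_twist hij.symm j).mul_left
      (h.commute_adjoint_twist hij.symm i)).eq, mul_assoc]

theorem semiconjBy_twist (h : IsDoublyTwistedNearIsometry T U) (hij : i ≠ j) :
    SemiconjBy (T i) (T j) (U i j * T j) := by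
  rw [SemiconjBy, h.mul_eq_twist_mul hij, mul_assoc]

theorem apply_mem_woldSubspace_of_ne (h : IsDoublyTwistedNearIsometry T U) (hij : i ≠ j) {c : ℕ∞}
    {x : H} (hx : x ∈ woldSubspace (T j) c) : T i x ∈ woldSubspace (T j) c :=
  apply_mem_woldSubspace (h.semiconjBy_twist hij) (h.commute_twist hij j).symm
    (h.commute_adjoint_twist hij j).symm (h.adjoint_mul_eq_twist_mul hij.symm) hx

theorem commute_starProjection_woldSubspace (h : IsDoublyTwistedNearIsometry T U) (hij : i ≠ j)
    (c d : ℕ∞) [(woldSubspace (T i) c).HasOrthogonalProjection]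
    [(woldSubspace (T j) d).HasOrthogonalProjection] :
    Commute (woldSubspace (T i) c).starProjection (woldSubspace (T j) d).starProjection := by
  have hT : Commute (woldSubspace (T i) c).starProjection (T j) :=
    (h.nearIsometry i).isInternalHilbertSum_woldSubspace.commute_starProjection
      (fun _ _ => h.apply_mem_woldSubspace_of_ne hij.symm) c
  have hT' : Commute (woldSubspace (T i) c).starProjection (adjoint (T j)) := by
    have := hT.star_star
    rwa [isSelfAdjoint_starProjection] at this
  exact ((h.nearIsometry j).isInternalHilbertSum_woldSubspace.commute_starProjection
    (fun _ _ => apply_mem_woldSubspace_of_commute hT hT') d).symm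

end IsDoublyTwistedNearIsometry

end TwistRelations

section JointWold

variable {H : Type*} [NormedAddCommGroup H] [InnerProductSpace ℂ H] [CompleteSpace H] {n : ℕ}
  {T : Fin n → H →L[ℂ] H} {U : Fin n → Fin n → H →L[ℂ] H} {k : Fin n → ℕ}
  {κ : Fin n → ℕ∞}

/-- The summands of the simultaneous Wold decomposition of the tuple `T`. -/
noncomputable def jointWoldSubspace (T : Fin n → H →L[ℂ] H) (κ : Fin n → ℕ∞) : Submodule ℂ H :=
  ⨅ i, woldSubspace (T i) (κ i)

theorem mem_jointWoldSubspace {x : H} :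
    x ∈ jointWoldSubspace T κ ↔ ∀ i, x ∈ woldSubspace (T i) (κ i) :=
  Submodule.mem_iInf _

namespace IsDoublyTwistedNearIsometry

theorem isInternalHilbertSum_jointWoldSubspace (h : IsDoublyTwistedNearIsometry T U) :
    IsInternalHilbertSum (jointWoldSubspace T) := by
  have hsum := fun i => (h.nearIsometry i).isInternalHilbertSum_woldSubspace
  have := fun i c => (hsum i).hasOrthogonalProjection c
  exact .iInf hsum fun i j hij c d => h.commute_starProjection_woldSubspace hij c d

theorem map_pow_jointWoldSubspace (h : IsDoublyTwistedNearIsometry T U) (i : Fin n) (m : ℕ) :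
    (jointWoldSubspace T κ).map ((T i ^ m : H →L[ℂ] H) : H →ₗ[ℂ] H) =
      jointWoldSubspace T (Function.update κ i (κ i + m)) := by
  have hinj := ((h.nearIsometry i).isClosedEmbedding_pow m).injective
  have hmap := map_pow_woldSubspace (h.nearIsometry i).injective (κ i) m
  have hpow : ∀ j ≠ i, ∀ c, ∀ x ∈ woldSubspace (T j) c, (T i ^ m) x ∈ woldSubspace (T j) c := by
    intro j hj c x hx
    rw [← ContinuousLinearMap.coe_coe, ContinuousLinearMap.toLinearMap_pow]
    exact Module.End.pow_apply_mem_of_forall_mem m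
      (fun y hy => h.apply_mem_woldSubspace_of_ne hj.symm hy) x hx
  refine le_antisymm ?_ fun x hx => ?_
  · rintro _ ⟨x, hx, rfl⟩
    rw [SetLike.mem_coe, mem_jointWoldSubspace] at hx
    refine mem_jointWoldSubspace.2 fun j => ?_
    obtain rfl | hj := eq_or_ne j i
    · rw [Function.update_self, ← hmap]
      exact Submodule.mem_map_of_mem (hx j)
    · rw [Function.update_of_ne hj]
      exact hpow j hj _ x (hx j)
  · rw [mem_jointWoldSubspace] at hx
    have hxi := hx i
    rw [Function.update_self, ← hmap] at hxi
    obtain ⟨y, hy, rfl⟩ := hxi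
    refine ⟨y, mem_jointWoldSubspace.2 fun j => ?_, rfl⟩
    obtain rfl | hj := eq_or_ne j i
    · exact hy
    · have hxj := hx j
      rw [Function.update_of_ne hj] at hxj
      exact (h.nearIsometry j).isInternalHilbertSum_woldSubspace.mem_of_apply_mem (hpow j hj)
        hinj hxj

theorem map_listPow_jointWoldSubspace (h : IsDoublyTwistedNearIsometry T U) {L : List (Fin n)}
    (hL : L.Nodup) : (jointWoldSubspace T κ).map ((listPow T L k : H →L[ℂ] H) : H →ₗ[ℂ] H) =
      jointWoldSubspace T fun i => κ i + if i ∈ L then (k i : ℕ∞) else 0 := by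
  induction L with
  | nil => simp [ContinuousLinearMap.one_def]
  | cons a L ih =>
    rw [List.nodup_cons] at hL
    have hcomp : ((listPow T (a :: L) k : H →L[ℂ] H) : H →ₗ[ℂ] H) =
        ((T a ^ k a : H →L[ℂ] H) : H →ₗ[ℂ] H) ∘ₗ ((listPow T L k : H →L[ℂ] H) : H →ₗ[ℂ] H) := rfl
    rw [hcomp, Submodule.map_comp, ih hL.2, h.map_pow_jointWoldSubspace]
    congr 1
    funext i
    obtain rfl | hi := eq_or_ne i a
    · simp [hL.1]
    · simp [hi]

end IsDoublyTwistedNearIsometry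

end JointWold

section TuplePow

variable {H : Type*} [NormedAddCommGroup H] [InnerProductSpace ℂ H] {n : ℕ}
  {T : Fin n → H →L[ℂ] H} {A : Finset (Fin n)} {k l : Fin n → ℕ} {i : Fin n}

/-- The elements of `A` in increasing order, in the form in which `tuplePow` enumerates them. -/
def indexList (A : Finset (Fin n)) : List (Fin n) := (List.finRange n).filter (fun a => a ∈ A)

theorem mem_indexList : i ∈ indexList A ↔ i ∈ A := by
  simp [indexList]

theorem nodup_indexList (A : Finset (Fin n)) : (indexList A).Nodup :=
  (List.nodup_finRange n).filter _

theorem tuplePow_eq_listPow : tuplePow T A k = listPow T (indexList A) k := rfl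

theorem tuplePow_congr (h : ∀ i ∈ A, k i = l i) : tuplePow T A k = tuplePow T A l :=
  listPow_congr fun i hi => h i (mem_indexList.1 hi)

theorem tuplePow_zero : tuplePow T A 0 = 1 := by
  simp [tuplePow_eq_listPow, listPow]

theorem tuplePow_single (hi : i ∈ A) (m : ℕ) :
    tuplePow T A (Pi.single i m) = T i ^ m := by
  have hprod : tuplePow T A (Pi.single i m) = (T i ^ (Pi.single i m : Fin n → ℕ) i) ^
      (indexList A).count i :=
    List.prod_map_eq_pow_single i _ fun j hj _ => by rw [Pi.single_eq_of_ne hj, pow_zero]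
  rw [hprod, List.count_eq_one_of_mem (nodup_indexList A) (mem_indexList.2 hi), pow_one,
    Pi.single_eq_same]

theorem exists_indexList_eq_append_cons (hi : i ∈ A) :
    ∃ L, i ∉ L ∧ indexList A = indexList {a ∈ A | a < i} ++ i :: L := by
  obtain ⟨L₁, L₂, hL⟩ := List.append_of_mem (mem_indexList.2 hi)
  have hsorted : (L₁ ++ i :: L₂).Pairwise (· < ·) :=
    hL ▸ (List.pairwise_lt_finRange n).filter _
  simp only [List.pairwise_append, List.pairwise_cons, List.mem_cons, forall_eq_or_imp] at hsorted
  obtain ⟨-, ⟨hi₂, -⟩, h₁⟩ := hsorted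
  have hfilter : indexList {a ∈ A | a < i} = (indexList A).filter (· < i) := by
    simp only [indexList, List.filter_filter, Finset.mem_filter, Bool.decide_and, Bool.and_comm]
  have hL₁ : L₁.filter (· < i) = L₁ := List.filter_eq_self.2 fun a ha => by simpa using (h₁ a ha).1
  have hL₂ : L₂.filter (· < i) = [] :=
    List.filter_eq_nil_iff.2 fun a ha => by simpa using (hi₂ a ha).le
  refine ⟨L₂, fun h => (hi₂ i h).false, ?_⟩
  rw [hfilter, hL, List.filter_append, hL₁, List.filter_cons_of_neg (by simp), hL₂, List.append_nil]

end TuplePow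

section Wandering

variable {H : Type*} [NormedAddCommGroup H] [InnerProductSpace ℂ H] [CompleteSpace H] {n : ℕ}
  {T : Fin n → H →L[ℂ] H} {U : Fin n → Fin n → H →L[ℂ] H} {A B : Finset (Fin n)}
  {k l : Fin n → ℕ}

/-- The index of the joint Wold summand `T_A^k D_A(T)`. -/
def woldIndex (A : Finset (Fin n)) (k : Fin n → ℕ) (i : Fin n) : ℕ∞ := if i ∈ A then k i else ⊤

theorem exists_eq_woldIndex (κ : Fin n → ℕ∞) : ∃ A k, κ = woldIndex A k := by
  refine ⟨({i | κ i ≠ ⊤} : Finset (Fin n)), fun i => (κ i).toNat, funext fun i => ?_⟩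
  by_cases hi : κ i = ⊤
  · simp [woldIndex, hi]
  · simp [woldIndex, hi, ENat.natCast_toNat hi]

theorem eq_and_forall_eq_of_woldIndex_eq (h : woldIndex A k = woldIndex B l) :
    A = B ∧ ∀ i ∈ A, k i = l i := by
  have hA : A = B := Finset.ext fun i => by
    have hi := congrFun h i
    by_cases hA : i ∈ A <;> by_cases hB : i ∈ B <;> simp_all [woldIndex]
  subst hA
  exact ⟨rfl, fun i hi => by simpa [woldIndex, hi] using congrFun h i⟩

theorem mem_kerSubspace {x : H} : x ∈ kerSubspace T A ↔ ∀ i ∈ A, x ∈ woldSubspace (T i) 0 := by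
  simp only [kerSubspace, woldSubspace_zero, Submodule.mem_iInf]

namespace IsDoublyTwistedNearIsometry

theorem map_tuplePow_jointWoldSubspace (h : IsDoublyTwistedNearIsometry T U) (A : Finset (Fin n))
    (κ : Fin n → ℕ∞) (k : Fin n → ℕ) :
    (jointWoldSubspace T κ).map ((tuplePow T A k : H →L[ℂ] H) : H →ₗ[ℂ] H) =
      jointWoldSubspace T fun i => κ i + if i ∈ A then (k i : ℕ∞) else 0 := by
  simp only [tuplePow_eq_listPow, h.map_listPow_jointWoldSubspace (nodup_indexList A),
    mem_indexList]

theorem wanderingSubspace_eq (h : IsDoublyTwistedNearIsometry T U) (A : Finset (Fin n)) :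
    wanderingSubspace T A = jointWoldSubspace T (woldIndex A 0) := by
  refine le_antisymm (fun x hx => ?_) (le_iInf fun l => ?_)
  · rw [wanderingSubspace, Submodule.mem_iInf] at hx
    refine mem_jointWoldSubspace.2 fun i => ?_
    by_cases hi : i ∈ A
    · obtain ⟨y, hy, rfl⟩ := hx 0
      simpa [woldIndex, hi, tuplePow_zero] using mem_kerSubspace.1 hy i hi
    · rw [woldIndex, if_neg hi, mem_woldSubspace_top]
      intro m
      obtain ⟨y, -, rfl⟩ := hx (Pi.single i m)
      rw [tuplePow_single (Finset.mem_compl.2 hi)]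
      exact ⟨y, rfl⟩
  · have hindex : woldIndex A 0 =
        fun i => woldIndex A 0 i + if i ∈ Aᶜ then (l i : ℕ∞) else 0 := by
      funext i
      by_cases hi : i ∈ A <;> simp [woldIndex, hi]
    have hker : jointWoldSubspace T (woldIndex A 0) ≤ kerSubspace T A := fun x hx =>
      mem_kerSubspace.2 fun i hi => by
        simpa [woldIndex, hi] using mem_jointWoldSubspace.1 hx i
    rw [hindex, ← h.map_tuplePow_jointWoldSubspace]
    exact Submodule.map_mono hker

theorem map_tuplePow_wanderingSubspace (h : IsDoublyTwistedNearIsometry T U)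
    (A : Finset (Fin n)) (k : Fin n → ℕ) :
    (wanderingSubspace T A).map ((tuplePow T A k : H →L[ℂ] H) : H →ₗ[ℂ] H) =
      jointWoldSubspace T (woldIndex A k) := by
  rw [h.wanderingSubspace_eq, h.map_tuplePow_jointWoldSubspace]
  congr 1
  funext i
  by_cases hi : i ∈ A <;> simp [woldIndex, hi]

theorem apply_mem_wanderingSubspace (h : IsDoublyTwistedNearIsometry T U) {j : Fin n}
    (hj : j ∉ A) {x : H} (hx : x ∈ wanderingSubspace T A) : T j x ∈ wanderingSubspace T A := by
  have hindex : Function.update (woldIndex A 0) j (woldIndex A 0 j + 1) = woldIndex A 0 := by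
    simp [Function.update_eq_self_iff, woldIndex, hj]
  have hmap := h.map_pow_jointWoldSubspace (κ := woldIndex A 0) j 1
  rw [pow_one, Nat.cast_one, hindex, ← h.wanderingSubspace_eq] at hmap
  exact hmap.le (Submodule.mem_map_of_mem hx)

theorem twist_apply_mem_wanderingSubspace (h : IsDoublyTwistedNearIsometry T U) {i j : Fin n}
    (hij : i ≠ j) {x : H} (hx : x ∈ wanderingSubspace T A) : U i j x ∈ wanderingSubspace T A := by
  rw [h.wanderingSubspace_eq, mem_jointWoldSubspace] at hx ⊢
  exact fun a => apply_mem_woldSubspace_of_commute (h.commute_twist hij a).symm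
    (h.commute_adjoint_twist hij a).symm (hx a)

theorem adjoint_tuplePow_mul_tuplePow_apply_mem (h : IsDoublyTwistedNearIsometry T U)
    (k : Fin n → ℕ) {x : H} (hx : x ∈ wanderingSubspace T A) :
    (adjoint (tuplePow T A k) * tuplePow T A k) x ∈ wanderingSubspace T A := by
  have hsum := h.isInternalHilbertSum_jointWoldSubspace
  rw [h.wanderingSubspace_eq] at hx ⊢
  have hinj : Function.Injective fun (κ : Fin n → ℕ∞) i =>
      κ i + if i ∈ A then (k i : ℕ∞) else 0 := fun κ κ' hκ => funext fun i => by
    refine ENat.add_left_injective_of_ne_top ?_ (congrFun hκ i)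
    split_ifs <;> simp
  have hmem : ∀ κ, ∀ y ∈ jointWoldSubspace T κ, tuplePow T A k y ∈
      jointWoldSubspace T fun i => κ i + if i ∈ A then (k i : ℕ∞) else 0 := fun κ y hy =>
    (h.map_tuplePow_jointWoldSubspace A κ k).le (Submodule.mem_map_of_mem hy)
  exact hsum.adjoint_apply_mem (fun _ _ => hsum.isOrtho) hinj hmem (hmem _ x hx)

theorem inner_tuplePow_of_woldIndex_ne (h : IsDoublyTwistedNearIsometry T U)
    (hne : woldIndex A k ≠ woldIndex B l) {x y : H} (hx : x ∈ wanderingSubspace T A)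
    (hy : y ∈ wanderingSubspace T B) : inner ℂ (tuplePow T A k x) (tuplePow T B l y) = 0 :=
  (h.isInternalHilbertSum_jointWoldSubspace.isOrtho hne).inner_eq
    ((h.map_tuplePow_wanderingSubspace A k).le (Submodule.mem_map_of_mem hx))
    ((h.map_tuplePow_wanderingSubspace B l).le (Submodule.mem_map_of_mem hy))

end IsDoublyTwistedNearIsometry

/-- The vectors `T_A^k x` with `x ∈ D_A(T)`; they span a dense subspace, and the wandering data
determine their Gram matrix. -/
noncomputable def wanderingFamily (T : Fin n → H →L[ℂ] H)
    (s : Σ A : Finset (Fin n), (Fin n → ℕ) × wanderingSubspace T A) : H :=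
  tuplePow T s.1 s.2.1 s.2.2

theorem IsDoublyTwistedNearIsometry.dense_span_range_wanderingFamily
    (h : IsDoublyTwistedNearIsometry T U) :
    Dense (Submodule.span ℂ (Set.range (wanderingFamily T)) : Set H) := by
  rw [Submodule.dense_iff_topologicalClosure_eq_top, Submodule.topologicalClosure_eq_top_iff,
    eq_bot_iff, ← h.isInternalHilbertSum_jointWoldSubspace.orthogonal_iSup_eq_bot]
  refine Submodule.orthogonal_le (iSup_le fun κ x hx => ?_)
  obtain ⟨A, k, rfl⟩ := exists_eq_woldIndex κ
  rw [← h.map_tuplePow_wanderingSubspace] at hx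
  obtain ⟨y, hy, rfl⟩ := hx
  exact Submodule.subset_span ⟨⟨A, k, y, hy⟩, rfl⟩

end Wandering

section Equivalence

variable {H K : Type*} [NormedAddCommGroup H] [InnerProductSpace ℂ H]
  [NormedAddCommGroup K] [InnerProductSpace ℂ K] {n : ℕ}

namespace IntertwinesOn

variable {D : Submodule ℂ H} {E : Submodule ℂ K} {V : D ≃ₗᵢ[ℂ] E} {X X₁ : H →L[ℂ] H}
  {Y Y₁ : K →L[ℂ] K}

theorem one : IntertwinesOn V 1 1 := fun x => ⟨x.2, rfl⟩

theorem mul (h : IntertwinesOn V X Y) (h₁ : IntertwinesOn V X₁ Y₁) :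
    IntertwinesOn V (X * X₁) (Y * Y₁) := by
  intro x
  obtain ⟨hx, hV⟩ := h₁ x
  obtain ⟨hx', hV'⟩ := h ⟨X₁ x, hx⟩
  exact ⟨hx', hV'.trans (congrArg Y hV)⟩

theorem pow (h : IntertwinesOn V X Y) (m : ℕ) : IntertwinesOn V (X ^ m) (Y ^ m) := by
  induction m with
  | zero => simpa only [pow_zero] using one
  | succ m ih => simpa only [pow_succ] using ih.mul h

theorem listPow {ι : Type*} {t : ι → H →L[ℂ] H} {t' : ι → K →L[ℂ] K} {L : List ι}
    (h : ∀ a ∈ L, IntertwinesOn V (t a) (t' a)) (k : ι → ℕ) :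
    IntertwinesOn V (listPow t L k) (listPow t' L k) := by
  induction L with
  | nil => exact one
  | cons a L ih =>
    rw [List.forall_mem_cons] at h
    simpa only [listPow_cons] using (h.1.pow (k a)).mul (ih h.2)

theorem tuplePow {t : Fin n → H →L[ℂ] H} {t' : Fin n → K →L[ℂ] K} {B : Finset (Fin n)}
    (h : ∀ a ∈ B, IntertwinesOn V (t a) (t' a)) (k : Fin n → ℕ) :
    IntertwinesOn V (tuplePow t B k) (tuplePow t' B k) :=
  listPow (fun a ha => h a (mem_indexList.1 ha)) k

theorem inner_apply_eq [CompleteSpace H] [CompleteSpace K]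
    (h : IntertwinesOn V (adjoint X * X) (adjoint Y * Y)) (x y : D) :
    inner ℂ (X x) (X y) = inner ℂ (Y (V x)) (Y (V y)) := by
  obtain ⟨hx, hV⟩ := h x
  calc inner ℂ (X x) (X y) = inner ℂ ((adjoint X * X) x) (y : H) :=
        (ContinuousLinearMap.adjoint_inner_left X _ _).symm
    _ = inner ℂ (V ⟨(adjoint X * X) x, hx⟩ : K) (V y) := ((V.inner_map_map ⟨_, hx⟩ y).symm :)
    _ = inner ℂ (Y (V x)) (Y (V y)) := by
        rw [hV, ← ContinuousLinearMap.adjoint_inner_left Y, mul_apply_eq_comp]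

end IntertwinesOn

variable [CompleteSpace H] [CompleteSpace K]
  {T : Fin n → H →L[ℂ] H} {U : Fin n → Fin n → H →L[ℂ] H}
  {T' : Fin n → K →L[ℂ] K} {U' : Fin n → Fin n → K →L[ℂ] K}
  {A : Finset (Fin n)} {k : Fin n → ℕ} {i j : Fin n}

theorem exists_linearIsometryEquiv_intertwinesOn_conj {D : Submodule ℂ H} {E : Submodule ℂ K}
    (V : H ≃ₗᵢ[ℂ] K) (hE : E = D.map (V : H →ₗ[ℂ] K)) : ∃ W : D ≃ₗᵢ[ℂ] E,
      ∀ X : H →L[ℂ] H, (∀ x ∈ D, X x ∈ D) → IntertwinesOn W X (V.conjStarAlgEquiv X) := by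
  subst hE
  refine ⟨V.submoduleMap D, fun X hX x => ⟨hX x x.2, ?_⟩⟩
  change V (X x) = V (X (V.symm (V x)))
  rw [V.symm_apply_apply]

theorem tuplePow_conj (V : H ≃ₗᵢ[ℂ] K) :
    tuplePow (fun i => V.conjStarAlgEquiv (T i)) A k = V.conjStarAlgEquiv (tuplePow T A k) :=
  (map_listPow V.conjStarAlgEquiv).symm

theorem apply_mem_kerSubspace_conj_iff (V : H ≃ₗᵢ[ℂ] K) {x : H} :
    V x ∈ kerSubspace (fun i => V.conjStarAlgEquiv (T i)) A ↔ x ∈ kerSubspace T A := by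
  have hadj : ∀ i, adjoint (V.conjStarAlgEquiv (T i)) (V x) = V (adjoint (T i) x) := fun i => by
    rw [← ContinuousLinearMap.star_eq_adjoint, ← map_star]
    exact congrArg (fun y => V (star (T i) y)) (V.symm_apply_apply x)
  simp only [kerSubspace, Submodule.mem_iInf, LinearMap.mem_ker, ContinuousLinearMap.coe_coe, hadj,
    LinearIsometryEquiv.map_eq_zero_iff]

theorem wanderingSubspace_conj (V : H ≃ₗᵢ[ℂ] K) (T : Fin n → H →L[ℂ] H) (A : Finset (Fin n)) :
    wanderingSubspace (fun i => V.conjStarAlgEquiv (T i)) A =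
      (wanderingSubspace T A).map (V : H →ₗ[ℂ] K) := by
  ext y
  obtain ⟨x, rfl⟩ := V.surjective y
  simp [wanderingSubspace, tuplePow_conj, V.surjective.exists, apply_mem_kerSubspace_conj_iff]

namespace IsDoublyTwistedNearIsometry

theorem eq_twist_of_commute (h : IsDoublyTwistedNearIsometry T U) (hij : i ≠ j) {c : H →L[ℂ] H}
    (hi : Commute c (T i)) (hj : Commute c (T j)) (hc : T i * T j = c * (T j * T i)) :
    c = U i j := by
  have hinj : Function.Injective (T j * T i : H →L[ℂ] H) :=
    (h.nearIsometry j).injective.comp (h.nearIsometry i).injective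
  have hcU : T j * T i * c = T j * T i * U i j := by
    rw [← (hj.mul_right hi).eq, ← hc, h.mul_eq_twist_mul hij,
      ((h.commute_twist hij j).mul_left (h.commute_twist hij i)).eq]
  exact ContinuousLinearMap.ext fun x => hinj (DFunLike.congr_fun hcU x)

theorem conj_twist_eq (h : IsDoublyTwistedNearIsometry T U) {V : H ≃ₗᵢ[ℂ] K}
    (h' : IsDoublyTwistedNearIsometry (fun i => V.conjStarAlgEquiv (T i)) U') (hij : i ≠ j) :
    V.conjStarAlgEquiv (U i j) = U' i j := by
  refine h'.eq_twist_of_commute hij ((h.commute_twist hij i).symm.map _)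
    ((h.commute_twist hij j).symm.map _) ?_
  simp only [← map_mul, h.mul_eq_twist_mul hij]

theorem mul_tuplePow_of_notMem (h : IsDoublyTwistedNearIsometry T U) (hi : i ∉ A) :
    T i * tuplePow T A k = tuplePow T A k * (tuplePow (U i) A k * T i) := by
  have hne : ∀ a ∈ indexList A, i ≠ a := fun a ha =>
    (ne_of_mem_of_not_mem (mem_indexList.1 ha) hi).symm
  exact mul_listPow (fun a ha => h.semiconjBy_twist (hne a ha))
    fun a ha b _ => (h.commute_twist (hne a ha) b).symm

theorem mul_tuplePow_of_mem (h : IsDoublyTwistedNearIsometry T U) (hi : i ∈ A) :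
    T i * tuplePow T A k = tuplePow T A (Function.update k i (k i + 1)) *
      tuplePow (U i) {a ∈ A | a < i} k := by
  obtain ⟨L, hL, hA⟩ := exists_indexList_eq_append_cons hi
  have hne : ∀ a ∈ indexList {a ∈ A | a < i}, i ≠ a := fun a ha =>
    (Finset.mem_filter.1 (mem_indexList.1 ha)).2.ne'
  simp only [tuplePow_eq_listPow, hA]
  exact mul_listPow_append_cons (fun hi => hne i hi rfl) hL
    (fun a ha => h.semiconjBy_twist (hne a ha)) fun a ha b _ => (h.commute_twist (hne a ha) b).symm

theorem inner_tuplePow_eq (h : IsDoublyTwistedNearIsometry T U)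
    (h' : IsDoublyTwistedNearIsometry T' U')
    {V : ∀ A, wanderingSubspace T A ≃ₗᵢ[ℂ] wanderingSubspace T' A}
    (hV : ∀ A k, IntertwinesOn (V A) (adjoint (tuplePow T A k) * tuplePow T A k)
      (adjoint (tuplePow T' A k) * tuplePow T' A k))
    {A B : Finset (Fin n)} {k l : Fin n → ℕ} (x : wanderingSubspace T A)
    (y : wanderingSubspace T B) :
    inner ℂ (tuplePow T A k x) (tuplePow T B l y) =
      inner ℂ (tuplePow T' A k (V A x)) (tuplePow T' B l (V B y)) := by
  by_cases hindex : woldIndex A k = woldIndex B l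
  · obtain ⟨rfl, hkl⟩ := eq_and_forall_eq_of_woldIndex_eq hindex
    rw [← tuplePow_congr hkl, ← tuplePow_congr hkl]
    exact (hV A k).inner_apply_eq x y
  · rw [h.inner_tuplePow_of_woldIndex_ne hindex x.2 y.2,
      h'.inner_tuplePow_of_woldIndex_ne hindex (V A x).2 (V B y).2]

theorem exists_linearIsometryEquiv_apply_tuplePow (h : IsDoublyTwistedNearIsometry T U)
    (h' : IsDoublyTwistedNearIsometry T' U')
    {V : ∀ A, wanderingSubspace T A ≃ₗᵢ[ℂ] wanderingSubspace T' A}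
    (hV : ∀ A k, IntertwinesOn (V A) (adjoint (tuplePow T A k) * tuplePow T A k)
      (adjoint (tuplePow T' A k) * tuplePow T' A k)) :
    ∃ W : H ≃ₗᵢ[ℂ] K, ∀ A k (x : wanderingSubspace T A),
      W (tuplePow T A k x) = tuplePow T' A k (V A x) := by
  let σ : (Σ A, (Fin n → ℕ) × wanderingSubspace T A) ≃
      Σ A, (Fin n → ℕ) × wanderingSubspace T' A :=
    Equiv.sigmaCongrRight fun A => (Equiv.refl _).prodCongr (V A).toEquiv
  have hrange : Set.range (wanderingFamily T' ∘ σ) = Set.range (wanderingFamily T') :=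
    EquivLike.range_comp _ σ
  obtain ⟨W, hW⟩ := exists_linearIsometryEquiv_of_inner_eq
    (p := wanderingFamily T) (q := wanderingFamily T' ∘ σ)
    (fun s t => h.inner_tuplePow_eq h' hV s.2.2 t.2.2)
    h.dense_span_range_wanderingFamily (hrange ▸ h'.dense_span_range_wanderingFamily)
  exact ⟨W, fun A k x => hW ⟨A, k, x⟩⟩

theorem tupleUnitarilyEquivalent (h : IsDoublyTwistedNearIsometry T U)
    (h' : IsDoublyTwistedNearIsometry T' U')
    {V : ∀ A, wanderingSubspace T A ≃ₗᵢ[ℂ] wanderingSubspace T' A}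
    (hV : ∀ A k, IntertwinesOn (V A) (adjoint (tuplePow T A k) * tuplePow T A k)
      (adjoint (tuplePow T' A k) * tuplePow T' A k))
    (hT : ∀ A, ∀ j ∉ A, IntertwinesOn (V A) (T j) (T' j))
    (hU : ∀ A i j, i ≠ j → IntertwinesOn (V A) (U i j) (U' i j)) :
    TupleUnitarilyEquivalent T T' := by
  obtain ⟨W, hW⟩ := h.exists_linearIsometryEquiv_apply_tuplePow h' hV
  have hWmul : ∀ {A k Z Z'} (x : wanderingSubspace T A), IntertwinesOn (V A) Z Z' →
      W ((tuplePow T A k * Z) x) = (tuplePow T' A k * Z') (V A x) := by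
    intro A k Z Z' x hZ
    obtain ⟨hx, hVx⟩ := hZ x
    exact (hW A k ⟨Z x, hx⟩).trans (congrArg (tuplePow T' A k) hVx)
  have hstep : ∀ i A k (x : wanderingSubspace T A),
      W ((T i * tuplePow T A k) x) = (T' i * tuplePow T' A k) (V A x) := by
    intro i A k x
    by_cases hi : i ∈ A
    · rw [h.mul_tuplePow_of_mem hi, h'.mul_tuplePow_of_mem hi]
      exact hWmul x (.tuplePow (fun a ha => hU A i a (Finset.mem_filter.1 ha).2.ne') k)
    · rw [h.mul_tuplePow_of_notMem hi, h'.mul_tuplePow_of_notMem hi]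
      have hne : ∀ a ∈ A, i ≠ a := fun a ha => (ne_of_mem_of_not_mem ha hi).symm
      exact hWmul x (.mul (.tuplePow (fun a ha => hU A i a (hne a ha)) k) (hT A i hi))
  have hintertwines : ∀ i, (W : H →L[ℂ] K) ∘L T i = T' i ∘L (W : H →L[ℂ] K) := fun i => by
    refine ContinuousLinearMap.ext_on h.dense_span_range_wanderingFamily ?_
    rintro _ ⟨⟨A, k, x⟩, rfl⟩
    exact (hstep i A k x).trans (congrArg (T' i) (hW A k x).symm)
  refine ⟨W, fun i y => ?_⟩
  have hy := DFunLike.congr_fun (hintertwines i) (W.symm y)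
  exact hy.trans (congrArg (T' i) (W.apply_symm_apply y))

theorem exists_linearIsometryEquiv_wanderingSubspace (h : IsDoublyTwistedNearIsometry T U)
    (h' : IsDoublyTwistedNearIsometry T' U') (hTT' : TupleUnitarilyEquivalent T T')
    (A : Finset (Fin n)) : ∃ V : wanderingSubspace T A ≃ₗᵢ[ℂ] wanderingSubspace T' A,
      (∀ k : Fin n → ℕ, IntertwinesOn V (adjoint (tuplePow T A k) * tuplePow T A k)
        (adjoint (tuplePow T' A k) * tuplePow T' A k)) ∧
      (∀ j, j ∉ A → IntertwinesOn V (T j) (T' j)) ∧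
      (∀ i j, i ≠ j → IntertwinesOn V (U i j) (U' i j)) := by
  obtain ⟨V, hV⟩ := hTT'
  obtain rfl : (fun i => V.conjStarAlgEquiv (T i)) = T' :=
    funext fun i => ContinuousLinearMap.ext (hV i)
  obtain ⟨W, hW⟩ :=
    exists_linearIsometryEquiv_intertwinesOn_conj V (wanderingSubspace_conj V T A)
  refine ⟨W, fun k => ?_, fun j hj => ?_, fun i j hij => ?_⟩
  · rw [tuplePow_conj]
    simp only [← ContinuousLinearMap.star_eq_adjoint, ← map_star, ← map_mul]
    exact hW _ fun x hx => h.adjoint_tuplePow_mul_tuplePow_apply_mem k hx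
  · exact hW _ fun x hx => h.apply_mem_wanderingSubspace hj hx
  · rw [← h.conj_twist_eq h' hij]
    exact hW _ fun x hx => h.twist_apply_mem_wanderingSubspace hij hx

theorem tupleUnitarilyEquivalent_iff (h : IsDoublyTwistedNearIsometry T U)
    (h' : IsDoublyTwistedNearIsometry T' U') : TupleUnitarilyEquivalent T T' ↔
      ∀ A : Finset (Fin n), ∃ V : wanderingSubspace T A ≃ₗᵢ[ℂ] wanderingSubspace T' A,
        (∀ k : Fin n → ℕ, IntertwinesOn V (adjoint (tuplePow T A k) * tuplePow T A k)
          (adjoint (tuplePow T' A k) * tuplePow T' A k)) ∧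
        (∀ j, j ∉ A → IntertwinesOn V (T j) (T' j)) ∧
        (∀ i j, i ≠ j → IntertwinesOn V (U i j) (U' i j)) := by
  refine ⟨h.exists_linearIsometryEquiv_wanderingSubspace h', fun hV => ?_⟩
  choose V hV hT hU using hV
  exact h.tupleUnitarilyEquivalent h' hV hT hU

end IsDoublyTwistedNearIsometry

end Equivalence

section Isometry

section CStarRing

variable {R : Type*} [NormedRing R] [StarRing R] [CStarRing R]

theorem eq_of_star_mul_eq_one {a b : R} (ha : star a * a = 1) (hb : star b * b = 1)
    (hab : star a * b = 1) : a = b := by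
  have hba : star b * a = 1 := by simpa using congrArg star hab
  refine sub_eq_zero.1 ((CStarRing.star_mul_self_eq_zero_iff _).1 ?_)
  rw [star_sub, sub_mul, mul_sub, mul_sub, ha, hb, hab, hba, sub_self]

theorem mul_eq_twist_mul_of_star_mul_eq {s t u : R} (hs : star s * s = 1) (ht : star t * t = 1)
    (hu : u ∈ unitary R) (hsu : Commute s u) (h : star s * t = star u * t * star s) :
    s * t = u * t * s := by
  have hut : star (u * t) * (u * t) = 1 :=
    star_mul_mul_self_eq_one (Unitary.star_mul_self_of_mem hu) ht
  have hsu' : Commute (star s) u := star_star u ▸ (commute_star_of_mem_unitary hu hsu).star_star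
  refine eq_of_star_mul_eq_one (star_mul_mul_self_eq_one hs ht)
    (star_mul_mul_self_eq_one hut hs) ?_
  calc star (s * t) * (u * t * s) = star t * ((star s * u) * t * s) := by
        simp only [star_mul, mul_assoc]
    _ = star t * (u * (star s * t) * s) := by rw [hsu'.eq, mul_assoc u]
    _ = star t * ((u * star u) * t * (star s * s)) := by rw [h]; simp only [mul_assoc]
    _ = 1 := by rw [Unitary.mul_star_self_of_mem hu, hs, one_mul, mul_one, ht]

end CStarRing

variable {H : Type*} [NormedAddCommGroup H] [InnerProductSpace ℂ H] [CompleteSpace H] {n : ℕ}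
  {T : Fin n → H →L[ℂ] H} {U : Fin n → Fin n → H →L[ℂ] H}

theorem star_mul_self_eq_one_of_isometry {S : H →L[ℂ] H} (hS : Isometry S) : star S * S = 1 :=
  S.isometry_iff_adjoint_comp_self.1 hS

theorem isNearIsometry_of_isometry {S : H →L[ℂ] H} (hS : Isometry S) : IsNearIsometry S where
  bounded_below := ⟨1, one_pos, fun x => by rw [one_mul, hS.norm_map_of_map_zero (map_zero S)]⟩
  contraction x := (hS.norm_map_of_map_zero (map_zero S) x).le
  range_condition m x := by
    have hpow : adjoint S ^ m * S ^ m = 1 :=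
      pow_mul_pow_eq_one m (star_mul_self_eq_one_of_isometry hS)
    refine ⟨x, ?_⟩
    rw [pow_succ]
    exact DFunLike.congr_fun hpow (S x)

namespace IsDoublyTwistedIsometry

theorem isDoublyTwistedNearIsometry (h : IsDoublyTwistedIsometry T U) :
    IsDoublyTwistedNearIsometry T U where
  twisting := h.twisting
  nearIsometry i := isNearIsometry_of_isometry (h.isometry i)
  adjoint_mul := h.adjoint_mul
  commute := h.commute
  mul_comm_twist i j hij :=
    mul_eq_twist_mul_of_star_mul_eq (star_mul_self_eq_one_of_isometry (h.isometry i))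
      (star_mul_self_eq_one_of_isometry (h.isometry j)) (h.twisting.mem_unitary i j hij)
      (h.commute i j i hij) (h.adjoint_mul i j hij)

theorem adjoint_tuplePow_mul_self (h : IsDoublyTwistedIsometry T U) (A : Finset (Fin n))
    (k : Fin n → ℕ) : adjoint (tuplePow T A k) * tuplePow T A k = 1 :=
  star_listPow_mul_self fun a _ => star_mul_self_eq_one_of_isometry (h.isometry a)

theorem tupleUnitarilyEquivalent_iff {K : Type*} [NormedAddCommGroup K] [InnerProductSpace ℂ K]
    [CompleteSpace K] {T' : Fin n → K →L[ℂ] K} {U' : Fin n → Fin n → K →L[ℂ] K}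
    (h : IsDoublyTwistedIsometry T U) (h' : IsDoublyTwistedIsometry T' U') :
    TupleUnitarilyEquivalent T T' ↔ ∀ A, WanderingDataEquivalent T U T' U' A := by
  rw [h.isDoublyTwistedNearIsometry.tupleUnitarilyEquivalent_iff h'.isDoublyTwistedNearIsometry]
  refine forall_congr' fun A => exists_congr fun V => and_iff_right fun k => ?_
  rw [h.adjoint_tuplePow_mul_self, h'.adjoint_tuplePow_mul_self]
  exact .one

end IsDoublyTwistedIsometry

end Isometry

theorem theorem1 {H K : Type*} [NormedAddCommGroup H] [InnerProductSpace ℂ H] [CompleteSpace H]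
    [NormedAddCommGroup K] [InnerProductSpace ℂ K] [CompleteSpace K] {n : ℕ}
    (T : Fin n → H →L[ℂ] H) (U : Fin n → Fin n → H →L[ℂ] H)
    (T' : Fin n → K →L[ℂ] K) (U' : Fin n → Fin n → K →L[ℂ] K) :
    -- the operators below leave the wandering subspaces invariant
    (IsDoublyTwistedNearIsometry T U → ∀ A : Finset (Fin n), ∀ x ∈ wanderingSubspace T A,
      (∀ k : Fin n → ℕ,
        (adjoint (tuplePow T A k) * tuplePow T A k) x ∈ wanderingSubspace T A) ∧
      (∀ j, j ∉ A → T j x ∈ wanderingSubspace T A) ∧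
      (∀ i j, i ≠ j → U i j x ∈ wanderingSubspace T A)) ∧
    -- the classification of doubly twisted near-isometries
    (IsDoublyTwistedNearIsometry T U → IsDoublyTwistedNearIsometry T' U' →
      (TupleUnitarilyEquivalent T T' ↔
        ∀ A : Finset (Fin n), ∃ V : wanderingSubspace T A ≃ₗᵢ[ℂ] wanderingSubspace T' A,
          (∀ k : Fin n → ℕ,
            IntertwinesOn V (adjoint (tuplePow T A k) * tuplePow T A k)
              (adjoint (tuplePow T' A k) * tuplePow T' A k)) ∧
          (∀ j, j ∉ A → IntertwinesOn V (T j) (T' j)) ∧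
          (∀ i j, i ≠ j → IntertwinesOn V (U i j) (U' i j)))) ∧
    -- the special case of doubly twisted isometries
    (IsDoublyTwistedIsometry T U → IsDoublyTwistedIsometry T' U' →
      IsDoublyTwistedNearIsometry T U ∧ IsDoublyTwistedNearIsometry T' U' ∧
      (TupleUnitarilyEquivalent T T' ↔
        ∀ A : Finset (Fin n), WanderingDataEquivalent T U T' U' A)) :=
  ⟨fun h _ _ hx => ⟨fun k => h.adjoint_tuplePow_mul_tuplePow_apply_mem k hx,
      fun _ hj => h.apply_mem_wanderingSubspace hj hx,
      fun _ _ hij => h.twist_apply_mem_wanderingSubspace hij hx⟩,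
    fun h h' => h.tupleUnitarilyEquivalent_iff h',
    fun h h' => ⟨h.isDoublyTwistedNearIsometry, h'.isDoublyTwistedNearIsometry,
      h.tupleUnitarilyEquivalent_iff h'⟩⟩
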